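/- Write $a^b=b^{-1}ab$, ${}^a b=aba^{-1}$ and $[a,b]=a^{-1}b^{-1}ab$. Let $\alpha,\beta\in\mathbb{Z}$ and let $\gamma\geq 1$ be an integer with $\alpha^\gamma\neq 1\neq\beta^\gamma$. Let $$W=\langle X,Y,Z\mid X^Z=X^\alpha,\ {}^ZY=Y^\beta,\ Z^\gamma=[X,Y]\rangle$$ be the Wamsley group, let $$G=\langle A,B\mid A^{[A,B]}=A^{\alpha^\gamma},\ {}^{[A,B]}B=B^{\beta^\gamma}\rangle$$ be the Macdonald group, and let $N$ be the kernel of the homomorphism $\Omega:G\to W$, $A\mapsto X$, $B\mapsto Y$. Then $G$ and $W$ are finite, and $\beta$ is invertible modulo the order of $B$. Let $\mu$ be any integer with $\beta\mu\equiv 1$ modulo the order of $B$, and let $N_0$ be the normal closure in $G$ of the $\gamma-1$ elements $$[A^{\alpha^i},B^{\mu^i}][A,B]^{-1},\qquad 1\leq i\leq\gamma-1.$$ Then $N=N_0$; the subgroup $\langle X,Y\rangle=\Omega(G)\cong G/N$ is normal in $W$, and $W/\langle X,Y\rangle$ is cyclic of order exactly $\gamma$; $$|W|=\gamma\,|G|/|N_0|;$$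 and $W$ is generated by elements $a,b,d$ (namely $a=X$, $b=Y$, $d=Z$) subject to the defining relations $$a^{[a,b]}=a^{\alpha^\gamma},\quad {}^{[a,b]}b=b^{\beta^\gamma},\quad [a^{\alpha^i},b^{\mu^i}]=[a,b]\ \ (1\leq i\leq\gamma-1),$$ $$a^d=a^\alpha,\quad b^d=b^\mu,\quad d^\gamma=[a,b],$$ where the relation $b^d=b^\mu$ may equivalently be replaced by ${}^db=b^\beta$. -/

import Mathlib

namespace Wamsley

/-- `a ^ b = b⁻¹ a b`, conjugation of `a` by `b` on the right. -/
def conjR {T : Type*} [Group T] (a b : T) : T := b⁻¹ * a * b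

/-- `ᵃ b = a b a⁻¹`, conjugation of `b` by `a` on the left. -/
def conjL {T : Type*} [Group T] (a b : T) : T := a * b * a⁻¹

/-- The commutator `[a, b] = a⁻¹ b⁻¹ a b` (Mathlib's `⁅a, b⁆` is `a b a⁻¹ b⁻¹`). -/
def comm {T : Type*} [Group T] (a b : T) : T := a⁻¹ * b⁻¹ * a * b

/-- Relators of the Macdonald group in two elements `a`, `b` of a group:
`a ^ [a,b] = a ^ (α ^ γ)` and `ᶜ b = b ^ (β ^ γ)` with `c = [a,b]`. -/
def macdonaldRelators {T : Type*} [Group T] (α β : ℤ) (γ : ℕ) (a b : T) : Set T :=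
  {conjR a (comm a b) * (a ^ (α ^ γ))⁻¹, conjL (comm a b) b * (b ^ (β ^ γ))⁻¹}

/-- Relators of the Wamsley group in three elements `x`, `y`, `z` of a group:
`x ^ z = x ^ α`, `ᶻ y = y ^ β` and `z ^ γ = [x,y]`. -/
def wamsleyRelators {T : Type*} [Group T] (α β : ℤ) (γ : ℕ) (x y z : T) : Set T :=
  {conjR x z * (x ^ α)⁻¹, conjL z y * (y ^ β)⁻¹, z ^ γ * (comm x y)⁻¹}

/-- The elements `[a ^ (α ^ i), b ^ (μ ^ i)] [a,b]⁻¹` for `i = 1, …, γ - 1`. -/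
def commRelators {T : Type*} [Group T] (α μ : ℤ) (γ : ℕ) (a b : T) : Set T :=
  {g | ∃ i : ℕ, 1 ≤ i ∧ i < γ ∧ g = comm (a ^ (α ^ i)) (b ^ (μ ^ i)) * (comm a b)⁻¹}

/-- The Macdonald group `G = ⟨A, B | A ^ [A,B] = A ^ (α ^ γ), ᶜ B = B ^ (β ^ γ)⟩`, `c = [A,B]`. -/
abbrev G (α β : ℤ) (γ : ℕ) : Type :=
  PresentedGroup (macdonaldRelators α β γ (FreeGroup.of (0 : Fin 2)) (FreeGroup.of 1))

/-- The Wamsley group `W = ⟨X, Y, Z | X ^ Z = X ^ α, ᶻ Y = Y ^ β, Z ^ γ = [X,Y]⟩`. -/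
abbrev W (α β : ℤ) (γ : ℕ) : Type :=
  PresentedGroup
    (wamsleyRelators α β γ (FreeGroup.of (0 : Fin 3)) (FreeGroup.of 1) (FreeGroup.of 2))

def A (α β : ℤ) (γ : ℕ) : G α β γ := PresentedGroup.of 0
def B (α β : ℤ) (γ : ℕ) : G α β γ := PresentedGroup.of 1
def X (α β : ℤ) (γ : ℕ) : W α β γ := PresentedGroup.of 0
def Y (α β : ℤ) (γ : ℕ) : W α β γ := PresentedGroup.of 1
def Z (α β : ℤ) (γ : ℕ) : W α β γ := PresentedGroup.of 2

theorem conjR_X_Z (α β : ℤ) (γ : ℕ) : conjR (X α β γ) (Z α β γ) = X α β γ ^ α := by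
  have h := PresentedGroup.one_of_mem (rels := wamsleyRelators α β γ
    (FreeGroup.of (0 : Fin 3)) (FreeGroup.of 1) (FreeGroup.of 2)) (Or.inl rfl)
  simp only [conjR, map_mul, map_inv, map_zpow, mul_inv_eq_one] at h
  exact h

theorem conjL_Z_Y (α β : ℤ) (γ : ℕ) : conjL (Z α β γ) (Y α β γ) = Y α β γ ^ β := by
  have h := PresentedGroup.one_of_mem (rels := wamsleyRelators α β γ
    (FreeGroup.of (0 : Fin 3)) (FreeGroup.of 1) (FreeGroup.of 2)) (Or.inr (Or.inl rfl))
  simp only [conjL, map_mul, map_inv, map_zpow, mul_inv_eq_one] at h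
  exact h

theorem Z_pow (α β : ℤ) (γ : ℕ) : Z α β γ ^ γ = comm (X α β γ) (Y α β γ) := by
  have h := PresentedGroup.one_of_mem (rels := wamsleyRelators α β γ
    (FreeGroup.of (0 : Fin 3)) (FreeGroup.of 1) (FreeGroup.of 2)) (Or.inr (Or.inr rfl))
  simp only [comm, map_mul, map_inv, map_pow, mul_inv_eq_one] at h
  exact h

theorem conjL_pow {T : Type*} [Group T] {z y : T} {β : ℤ} (h : conjL z y = y ^ β) (n : ℕ) :
    conjL (z ^ n) y = y ^ (β ^ n) := by
  induction n with
  | zero => simp [conjL]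
  | succ n ih =>
    have e : conjL (z ^ (n + 1)) y = z * conjL (z ^ n) y * z⁻¹ := by
      simp only [conjL, pow_succ']; group
    rw [e, ih, ← conj_zpow, show z * y * z⁻¹ = y ^ β from h, ← zpow_mul, pow_succ']

theorem conjR_pow {T : Type*} [Group T] {z x : T} {α : ℤ} (h : conjR x z = x ^ α) (n : ℕ) :
    conjR x (z ^ n) = x ^ (α ^ n) := by
  have := conjL_pow (z := z⁻¹) (y := x) (β := α) (by simpa [conjL, conjR] using h) n
  simpa [conjL, conjR] using this

/-- The homomorphism `Ω : G → W` with `A ↦ X`, `B ↦ Y`. -/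
def Omega (α β : ℤ) (γ : ℕ) : G α β γ →* W α β γ :=
  PresentedGroup.toGroup (f := ![X α β γ, Y α β γ]) (by
    intro r hr
    rcases hr with rfl | rfl
    · have := conjR_pow (conjR_X_Z α β γ) γ
      rw [Z_pow] at this
      simpa [conjR, comm, mul_inv_eq_one] using this
    · have := conjL_pow (conjL_Z_Y α β γ) γ
      rw [Z_pow] at this
      simpa [conjL, comm, mul_inv_eq_one] using this)

theorem Omega_A (α β : ℤ) (γ : ℕ) : Omega α β γ (A α β γ) = X α β γ :=
  PresentedGroup.toGroup.of _

theorem Omega_B (α β : ℤ) (γ : ℕ) : Omega α β γ (B α β γ) = Y α β γ :=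
  PresentedGroup.toGroup.of _

/-- `N` is the kernel of `Ω`. -/
def N (α β : ℤ) (γ : ℕ) : Subgroup (G α β γ) := (Omega α β γ).ker

/-- `N₀` is the normal closure in `G` of the elements `[A ^ (α ^ i), B ^ (μ ^ i)] [A,B]⁻¹`,
`1 ≤ i ≤ γ - 1`. -/
def N₀ (α β : ℤ) (γ : ℕ) (μ : ℤ) : Subgroup (G α β γ) :=
  Subgroup.normalClosure (commRelators α μ γ (A α β γ) (B α β γ))

/-- The subgroup `⟨X, Y⟩` of `W`. -/
def XY (α β : ℤ) (γ : ℕ) : Subgroup (W α β γ) := Subgroup.closure {X α β γ, Y α β γ}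

/-- Relators of the second presentation of `W` in elements `a`, `b`, `d`: the Macdonald relators,
the relators of `[a ^ (α ^ i), b ^ (μ ^ i)] = [a,b]` for `1 ≤ i ≤ γ - 1`, and those of
`a ^ d = a ^ α`, `b ^ d = b ^ μ`, `d ^ γ = [a,b]`. -/
def extRelators {T : Type*} [Group T] (α β : ℤ) (γ : ℕ) (μ : ℤ) (a b d : T) : Set T :=
  macdonaldRelators α β γ a b ∪ commRelators α μ γ a b ∪
    {conjR a d * (a ^ α)⁻¹, conjR b d * (b ^ μ)⁻¹, d ^ γ * (comm a b)⁻¹}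

/-- The variant of `extRelators` in which `b ^ d = b ^ μ` is replaced by `ᵈ b = b ^ β`. -/
def extRelators' {T : Type*} [Group T] (α β : ℤ) (γ : ℕ) (μ : ℤ) (a b d : T) : Set T :=
  macdonaldRelators α β γ a b ∪ commRelators α μ γ a b ∪
    {conjR a d * (a ^ α)⁻¹, conjL d b * (b ^ β)⁻¹, d ^ γ * (comm a b)⁻¹}

/-- The group generated by `a`, `b`, `d` subject to the relators `extRelators`. -/
abbrev E (α β : ℤ) (γ : ℕ) (μ : ℤ) : Type :=
  PresentedGroup
    (extRelators α β γ μ (FreeGroup.of (0 : Fin 3)) (FreeGroup.of 1) (FreeGroup.of 2))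

/-- The group generated by `a`, `b`, `d` subject to the relators `extRelators'`. -/
abbrev E' (α β : ℤ) (γ : ℕ) (μ : ℤ) : Type :=
  PresentedGroup
    (extRelators' α β γ μ (FreeGroup.of (0 : Fin 3)) (FreeGroup.of 1) (FreeGroup.of 2))

end Wamsley

/-! The main point is that a Macdonald pair `a`, `b` generates a finite group. Put `c = [a,b]`, `p =
α ^ γ`, `q = β ^ γ`. Conjugation by `c⁻¹` raises `a` to the power `p`, conjugation by `c` raises `b`
to the power `q`, and computing `[a, b ^ (q ^ 2)]` in two ways gives `key_relation` between powers
of `a`, `b`, `c`. For `|p|, |q| ≥ 2` its exponent of `a` is non-zero and this forces `a` to have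
finite order (`isOfFinOrder_left_of_two_le`); the values `0` and `-1` need separate arguments. The
group is then the finite product `⟨a⟩⟨c⟩⟨b⟩`.

`Ω` kills `N₀`, since conjugation by `Z ^ i` sends `X`, `Y` to `X ^ (α ^ i)`, `Y ^ (μ ^ i)` and
fixes `Z ^ γ = [X,Y]`. Conversely, the relators of `N₀` make `a ↦ a ^ α`, `b ↦ b ^ μ` an
automorphism `σ` of `G ⧸ N₀` that fixes `c` and has `σ ^ γ` equal to conjugation by `c`. Hence `G ⧸
N₀` embeds in a group with an element `d` inducing `σ` and satisfying `d ^ γ = c`. The Wamsley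
relations hold there, so `G → G ⧸ N₀` followed by this embedding factors through `Ω`, and `ker Ω ≤
N₀`. -/

namespace Wamsley

/-! ### Exponent sums and criteria for finite order. -/

/-- A pair `a`, `b` of elements of a group satisfying the two relations of the Macdonald group
with parameters `p` and `q`. -/
structure IsMacdonaldPair {T : Type*} [Group T] (p q : ℤ) (a b : T) : Prop where
  conjR_eq : conjR a (comm a b) = a ^ p
  conjL_eq : conjL (comm a b) b = b ^ q

/-- `p + p² + ⋯ + pⁿ`. -/
def powSum (p : ℤ) (n : ℕ) : ℤ := ∑ i ∈ Finset.range n, p ^ (i + 1)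

theorem powSum_succ (p : ℤ) (n : ℕ) : powSum p (n + 1) = powSum p n + p ^ (n + 1) :=
  Finset.sum_range_succ _ _

/-- The exponent `p + p² + ⋯ + pⁿ - pⁿ⁺²`, where `n = p²`. -/
def keyExp (p : ℤ) : ℤ := powSum p (p.natAbs ^ 2) - p ^ (p.natAbs ^ 2 + 2)

theorem abs_powSum_lt {p : ℤ} (hp : 2 ≤ |p|) (n : ℕ) : |powSum p n| < |p| ^ (n + 1) := by
  induction n with
  | zero => simp only [powSum, Finset.range_zero, Finset.sum_empty, abs_zero, zero_add, pow_one]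
            omega
  | succ n ih =>
    rw [powSum_succ]
    calc |powSum p n + p ^ (n + 1)| ≤ |powSum p n| + |p ^ (n + 1)| := abs_add_le _ _
      _ < |p| ^ (n + 1) * 2 := by rw [abs_pow]; omega
      _ ≤ |p| ^ (n + 1) * |p| := by gcongr
      _ = |p| ^ (n + 1 + 1) := (pow_succ _ _).symm

theorem keyExp_ne_zero {p : ℤ} (hp : 2 ≤ |p|) : keyExp p ≠ 0 := by
  intro h
  have h1 := abs_powSum_lt hp (p.natAbs ^ 2)
  rw [sub_eq_zero.mp h, abs_pow] at h1
  exact absurd h1 (not_lt.mpr (pow_le_pow_right₀ (by omega) (by omega)))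

theorem keyExp_neg_one : keyExp (-1) = 0 := by decide

theorem isOfFinOrder_of_zpow_eq {T : Type*} [Group T] {x : T} {m n : ℤ} (hmn : m ≠ n)
    (h : x ^ m = x ^ n) : IsOfFinOrder x := by
  rw [isOfFinOrder_iff_zpow_eq_one]
  exact ⟨m - n, sub_ne_zero.mpr hmn, by rw [zpow_sub, h, mul_inv_cancel]⟩

theorem isOfFinOrder_of_zpow {T : Type*} [Group T] {x : T} {m : ℤ} (hm : m ≠ 0)
    (h : IsOfFinOrder (x ^ m)) : IsOfFinOrder x := by
  rw [isOfFinOrder_iff_zpow_eq_one] at h ⊢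
  obtain ⟨n, hn, h⟩ := h
  exact ⟨m * n, mul_ne_zero hm hn, by rw [zpow_mul, h]⟩

/-- Modulo a subgroup `H` normalized by `c`, the powers of `x * c` with `x ∈ H` are those
of `c`. -/
theorem mul_zpow_mul_zpow_neg_mem {T : Type*} [Group T] {H : Subgroup T} {c x : T}
    (hc : c ∈ Subgroup.normalizer (H : Set T)) (hx : x ∈ H) (n : ℤ) :
    (x * c) ^ n * c ^ (-n) ∈ H := by
  have key (k : ℤ) {y : T} (hy : y ∈ H) : c ^ k * y * c ^ (-k) ∈ H := by
    rw [zpow_neg]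
    exact (Subgroup.mem_normalizer_iff.mp (zpow_mem hc k) y).mp hy
  induction n with
  | zero => simp
  | succ n ih =>
    convert H.mul_mem ih (key n hx) using 1
    rw [zpow_add_one, neg_add, zpow_add]
    group
  | pred n ih =>
    convert H.mul_mem ih (key (-n - 1) (H.inv_mem hx)) using 1
    rw [zpow_sub_one]
    group

/-- The relation alone gives only that conjugation by `c` maps `⟨x⟩` into itself; finiteness of
`⟨x⟩` makes this an equality. -/
theorem mem_normalizer_zpowers_of_conj {T : Type*} [Group T] {x c : T} {p : ℤ}
    (hx : IsOfFinOrder x) (h : c * x * c⁻¹ = x ^ p) :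
    c ∈ Subgroup.normalizer (Subgroup.zpowers x : Set T) := by
  have : Finite (Subgroup.zpowers x : Set T) := hx.finite_zpowers
  refine Subgroup.mem_normalizer_fintype ?_
  rintro _ ⟨n, rfl⟩
  exact ⟨p * n, by simp only; rw [← conj_zpow, h, zpow_mul]⟩

/-- If `c * x * c⁻¹ = x ^ p`, then a power `cⁿ` commuting with `x` forces `x` to have
finite order. -/
theorem isOfFinOrder_of_commute_zpow {T : Type*} [Group T] {x c : T} {p : ℤ} (hp : 2 ≤ |p|)
    (h : c * x * c⁻¹ = x ^ p) {n : ℤ} (hn : n ≠ 0) (hc : Commute (c ^ n) x) :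
    IsOfFinOrder x := by
  have hc' : Commute (c ^ n.natAbs) x := by
    obtain ⟨m, rfl | rfl⟩ := n.eq_nat_or_neg <;> simpa using hc
  have h1 := conjL_pow (z := c) (y := x) h n.natAbs
  rw [conjL, hc'.eq, mul_inv_cancel_right] at h1
  refine isOfFinOrder_of_zpow_eq (m := 1) (n := p ^ n.natAbs) ?_ (by simpa using h1)
  intro h2
  have h3 : |p| ^ n.natAbs = 1 := by rw [← abs_pow, ← h2, abs_one]
  have := one_lt_pow₀ (show 1 < |p| by omega) (Int.natAbs_ne_zero.mpr hn)
  omega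

/-! ### The key relation, and the case `|p|, |q| ≥ 2`. -/

namespace IsMacdonaldPair

variable {T : Type*} [Group T] {p q : ℤ} {a b : T}

/-- As `[b,a] = [a,b]⁻¹`, the two relations trade places, so each result about `a` yields one about
`b`. -/
theorem symm (h : IsMacdonaldPair p q a b) : IsMacdonaldPair q p b a := by
  have e : comm b a = (comm a b)⁻¹ := by simp only [comm]; group
  refine ⟨?_, ?_⟩
  · rw [← h.conjL_eq, e]; simp [conjL, conjR]
  · rw [← h.conjR_eq, e]; simp [conjL, conjR]

theorem zpow_mul_comm_pow (h : IsMacdonaldPair p q a b) (k : ℤ) (n : ℕ) :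
    a ^ k * comm a b ^ n = comm a b ^ n * a ^ (p ^ n * k) := by
  have := conjR_pow h.conjR_eq n
  rw [zpow_mul, ← this]
  have e : conjR a (comm a b ^ n) ^ k = (comm a b ^ n)⁻¹ * a ^ k * comm a b ^ n := by
    simpa [conjR] using
      conj_zpow (i := k) (a := (comm a b ^ n)⁻¹) (b := a)
  rw [e]
  group

theorem comm_pow_mul_zpow (h : IsMacdonaldPair p q a b) (k : ℤ) (n : ℕ) :
    comm a b ^ n * b ^ k = b ^ (q ^ n * k) * comm a b ^ n := by
  rw [zpow_mul, ← conjL_pow h.conjL_eq n, conjL, conj_zpow]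
  group

theorem conj_pow_left (h : IsMacdonaldPair p q a b) (n : ℕ) :
    b⁻¹ * a ^ n * b = comm a b ^ n * a ^ powSum p n := by
  have e : b⁻¹ * a * b = a * comm a b := by simp only [comm]; group
  have e2 : b⁻¹ * a ^ n * b = (a * comm a b) ^ n := by
    rw [← e]; simpa using (conj_pow (i := n) (a := b⁻¹) (b := a)).symm
  rw [e2]
  clear e2
  induction n with
  | zero => simp [powSum]
  | succ n ih =>
    have := h.zpow_mul_comm_pow 1 (n + 1)
    rw [zpow_one, mul_one] at this
    rw [pow_succ' (a * comm a b), ih, powSum_succ, add_comm (powSum p n), zpow_add, ← mul_assoc (comm a b ^ _),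
      ← this, pow_succ']
    group

theorem conj_pow_right (h : IsMacdonaldPair p q a b) (n : ℕ) :
    a⁻¹ * b ^ n * a = (comm a b ^ n)⁻¹ * b ^ powSum q n := by
  rw [h.symm.conj_pow_left n, ← inv_pow]
  congr 2
  simp only [comm]; group

/-- Both sides are `[a, b ^ (q ^ 2)]`, computed in two ways. -/
theorem key_relation (h : IsMacdonaldPair p q a b) :
    comm a b ^ (p.natAbs ^ 2 + 2) * a ^ keyExp p =
      b ^ (-keyExp q) * comm a b ^ (q.natAbs ^ 2 + 2) := by
  have eP : ((p.natAbs ^ 2 : ℕ) : ℤ) = p ^ 2 := by simp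
  have eQ : ((q.natAbs ^ 2 : ℕ) : ℤ) = q ^ 2 := by simp
  have h1 := h.conj_pow_left (p.natAbs ^ 2)
  have h2 := h.conj_pow_right (q.natAbs ^ 2)
  rw [keyExp, keyExp]
  generalize p.natAbs ^ 2 = P at *
  generalize q.natAbs ^ 2 = Q at *
  have h3 := h.zpow_mul_comm_pow 1 2
  have h4 := h.comm_pow_mul_zpow 1 2
  have h5 := h.zpow_mul_comm_pow (-1) (P + 2)
  have h6 := h.comm_pow_mul_zpow Q Q
  rw [mul_one, ← eP, zpow_natCast, zpow_one] at h3
  rw [mul_one, ← eQ, zpow_natCast, zpow_one] at h4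
  rw [zpow_natCast] at h6
  generalize comm a b = c at *
  -- Reason for the exponents `p ^ 2` and `q ^ 2`: such powers of `a` and `b` are conjugates by `c ^
  -- 2` and its inverse, and the exponents are non-negative, as `conj_pow_left` and `conj_pow_right`
  -- require.
  have hA : a ^ P = (c ^ 2)⁻¹ * a * c ^ 2 := by rw [mul_assoc, h3]; group
  have hB : b ^ Q = c ^ 2 * b * (c ^ 2)⁻¹ := by rw [h4]; group
  have h7 : a⁻¹ * (b ^ Q)⁻¹ * a * b ^ Q = a⁻¹ * c ^ (P + 2) * a ^ powSum p P * (c ^ 2)⁻¹ := by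
    rw [hA] at h1
    calc _ = a⁻¹ * (c ^ 2 * (b⁻¹ * ((c ^ 2)⁻¹ * a * c ^ 2) * b) * (c ^ 2)⁻¹) := by rw [hB]; group
      _ = _ := by rw [h1, add_comm, pow_add]; group
  have h8 : a⁻¹ * (b ^ Q)⁻¹ * a * b ^ Q = b ^ (-powSum q Q) * (c ^ Q * b ^ Q) := by
    calc _ = (a⁻¹ * b ^ Q * a)⁻¹ * b ^ Q := by group
      _ = _ := by rw [h2]; group
  rw [h6] at h8
  rw [h8, ← zpow_neg_one a, h5] at h7
  have h9 := congrArg (· * c ^ 2) h7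
  simp only [inv_mul_cancel_right] at h9
  rw [show powSum p P - p ^ (P + 2) = p ^ (P + 2) * -1 + powSum p P by ring, zpow_add,
    ← mul_assoc, ← h9, show -(powSum q Q - q ^ (Q + 2)) = -powSum q Q + q ^ Q * Q by
      rw [eQ]; ring, zpow_add, pow_add]
  simp only [mul_assoc]

/-- The subgroup generated by the conjugates of `a` under the powers of `[a, b]` consists of
elements commuting with `a`. -/
theorem commute_of_mem_closure (h : IsMacdonaldPair p q a b) {x : T}
    (hx : x ∈ Subgroup.closure
      (Set.range fun i : ℤ ↦ comm a b ^ i * a * (comm a b ^ i)⁻¹)) : Commute x a := by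
  have hle : Subgroup.closure (Set.range fun i : ℤ ↦ comm a b ^ i * a * (comm a b ^ i)⁻¹) ≤
      Subgroup.centralizer {a} := by
    rw [Subgroup.closure_le]
    rintro _ ⟨i, rfl⟩
    rw [SetLike.mem_coe, Subgroup.mem_centralizer_singleton_iff]
    -- For `i = -n` the conjugate is a power of `a`; the case `i = n` follows on conjugating by `c ^
    -- n`.
    have hn (n : ℕ) : Commute ((comm a b ^ n)⁻¹ * a * comm a b ^ n) a := by
      have := conjR_pow h.conjR_eq n
      rw [conjR] at this
      rw [this]
      exact (Commute.refl a).zpow_left _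
    obtain ⟨n, rfl | rfl⟩ := i.eq_nat_or_neg
    · have h2 := (Commute.conj_iff (comm a b ^ n)).mpr (hn n)
      simp only [mul_assoc, mul_inv_cancel_left, mul_inv_cancel, mul_one] at h2
      simpa [mul_assoc] using h2.symm.eq
    · simpa [mul_assoc] using (hn n).eq
  exact Subgroup.mem_centralizer_singleton_iff.mp (hle hx)

theorem comm_mul_inv (h : IsMacdonaldPair p q a b) :
    (comm a b)⁻¹ * a * (comm a b)⁻¹⁻¹ = a ^ p := by
  simpa [conjR] using h.conjR_eq

theorem isOfFinOrder_left_of_two_le (h : IsMacdonaldPair p q a b) (hp : 2 ≤ |p|)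
    (hq : 2 ≤ |q|) : IsOfFinOrder a := by
  have hq1 : q ≠ 1 := by rintro rfl; simp at hq
  have hpq : p * q ≠ 1 := by
    intro e
    have := congrArg abs e
    rw [abs_mul, abs_one] at this
    nlinarith
  have hkey := h.key_relation
  have hw := keyExp_ne_zero hp
  generalize keyExp p = w at *
  generalize keyExp q = w' at *
  generalize p.natAbs ^ 2 + 2 = P at *
  generalize q.natAbs ^ 2 + 2 = Q at *
  set k : ℤ := Q - P with hk
  set c := comm a b with hc
  have hcb : b ^ q = c * b * c⁻¹ := h.conjL_eq.symm
  have hca : a ^ p = c⁻¹ * a * c := h.conjR_eq.symm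
  -- By the key relation this element is conjugate, through a power of `c`, to a power of `b`; hence
  -- conjugation by `c` raises it to the power `q`.
  have h1 : a ^ w * c ^ (-k) = (c ^ P)⁻¹ * b ^ (-w') * c ^ P := by
    rw [show a ^ w = (c ^ P)⁻¹ * (b ^ (-w') * c ^ Q) by rw [← hkey]; group, hk]
    group
  have h2 : a ^ w * c ^ (-k) = (a ^ (w * p) * c ^ (-k)) ^ q := by
    have e1 : a ^ (w * p) * c ^ (-k) = c⁻¹ * (a ^ w * c ^ (-k)) * c := by
      have : a ^ (w * p) = c⁻¹ * a ^ w * c := by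
        rw [mul_comm, zpow_mul, hca]
        simpa using conj_zpow (i := w) (a := c⁻¹) (b := a)
      rw [this]; group
    have e2 : c⁻¹ * (a ^ w * c ^ (-k)) * c =
        (c⁻¹ * (c ^ P)⁻¹) * b ^ (-w') * (c⁻¹ * (c ^ P)⁻¹)⁻¹ := by
      rw [h1]; group
    rw [e1, e2, conj_zpow, zpow_comm, hcb, conj_zpow, h1]
    group
  by_cases hk0 : k = 0
  · refine isOfFinOrder_of_zpow_eq (m := w) (n := w * p * q) ?_ ?_
    · intro e
      apply hpq
      have : w * (p * q) = w * 1 := by rw [← mul_assoc, ← e, mul_one]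
      exact mul_left_cancel₀ hw this
    · simpa [hk0, ← zpow_mul] using h2
  · set H := Subgroup.closure (Set.range fun i : ℤ ↦ c ^ i * a * (c ^ i)⁻¹) with hH
    have haH : a ∈ H := Subgroup.subset_closure ⟨0, by simp⟩
    have hcH : c ∈ Subgroup.normalizer (H : Set T) := by
      have aux (j : ℤ) {x : T} (hx : x ∈ H) : c ^ j * x * (c ^ j)⁻¹ ∈ H := by
        induction hx using Subgroup.closure_induction with
        | mem x hx =>
          obtain ⟨i, rfl⟩ := hx
          refine Subgroup.subset_closure ⟨j + i, ?_⟩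
          simp only [zpow_add]; group
        | one => simp
        | mul x y _ _ hx hy => convert H.mul_mem hx hy using 1; group
        | inv x _ hx => convert H.inv_mem hx using 1; group
      rw [Subgroup.mem_normalizer_iff]
      refine fun x ↦ ⟨fun hx ↦ by simpa using aux 1 hx, fun hx ↦ ?_⟩
      have := aux (-1) hx
      simpa [mul_assoc] using this
    -- Modulo `H`, which contains `a` and is normalized by `c`, the relation `h2` reads `c ^ (-k) =
    -- c ^ (-k * q)`. So a non-trivial power of `c` lies in `H` and commutes with `a`.
    have h3 := mul_zpow_mul_zpow_neg_mem (zpow_mem hcH (-k)) (H.zpow_mem haH (w * p)) q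
    rw [← h2, mul_assoc] at h3
    have h4 : c ^ (k * (q - 1)) ∈ H := by
      convert (Subgroup.mul_mem_cancel_left H (H.zpow_mem haH w)).mp h3 using 1
      rw [← zpow_mul, ← zpow_add]
      congr 1; ring
    have h5 : Commute (c⁻¹ ^ (k * (q - 1))) a := by
      rw [inv_zpow]; exact (h.commute_of_mem_closure h4).inv_left
    exact isOfFinOrder_of_commute_zpow hp h.comm_mul_inv
      (mul_ne_zero hk0 (sub_ne_zero.mpr hq1)) h5

end IsMacdonaldPair
end Wamsley

/-! ### The exponents `0` and `-1`, and finiteness of the group. -/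

namespace Wamsley
namespace IsMacdonaldPair

variable {T : Type*} [Group T] {p q : ℤ} {a b : T}

/-- For `n` the order of `a`, `conj_pow_left` makes `c ^ n` a power of `a`. -/
theorem isOfFinOrder_comm (h : IsMacdonaldPair p q a b) (ha : IsOfFinOrder a) :
    IsOfFinOrder (comm a b) := by
  have h1 := h.conj_pow_left (orderOf a)
  rw [pow_orderOf_eq_one, mul_one, inv_mul_cancel, eq_comm, mul_eq_one_iff_eq_inv] at h1
  refine isOfFinOrder_of_zpow (m := orderOf a) (by exact_mod_cast ha.orderOf_pos.ne') ?_
  rw [zpow_natCast, h1, isOfFinOrder_inv_iff]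
  exact ha.zpow

theorem isOfFinOrder_comm' (h : IsMacdonaldPair p q a b) (hb : IsOfFinOrder b) :
    IsOfFinOrder (comm a b) := by
  rw [← isOfFinOrder_inv_iff]
  convert h.symm.isOfFinOrder_comm hb using 1
  simp only [comm]; group

/-- Since `keyExp (-1) = 0`, `a` drops out of the key relation, and `c ^ (q ^ 2 - 1)` is a power of
`b`, hence commutes with `b`. -/
theorem isOfFinOrder_right_of_neg_one (h : IsMacdonaldPair (-1) q a b) (hq : 2 ≤ |q|) :
    IsOfFinOrder b := by
  have hkey := h.key_relation
  rw [keyExp_neg_one, zpow_zero, mul_one] at hkey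
  have hQ : q.natAbs ^ 2 ≠ 1 := by
    intro e
    have e2 := Nat.pow_eq_one.mp e
    rw [Int.abs_eq_natAbs] at hq
    omega
  have h1 : comm a b ^ ((q.natAbs ^ 2 : ℕ) - 1 : ℤ) = b ^ keyExp q := by
    calc _ = b ^ keyExp q * (b ^ (-keyExp q) * comm a b ^ (q.natAbs ^ 2 + 2)) *
          comm a b ^ (-3 : ℤ) := by group
      _ = _ := by rw [← hkey]; group
  refine isOfFinOrder_of_commute_zpow hq h.conjL_eq (n := (q.natAbs ^ 2 : ℕ) - 1) (by omega) ?_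
  rw [h1]
  exact (Commute.refl b).zpow_left _

theorem zpow_neg_two_eq (h : IsMacdonaldPair (-1) q a b) :
    a ^ (-2 : ℤ) = a⁻¹ * b ^ (-q) * a * b ^ q * comm a b := by
  have h1 : b ^ q = comm a b * b * (comm a b)⁻¹ := h.conjL_eq.symm
  have h2 : (comm a b)⁻¹ * a * comm a b = a⁻¹ := by simpa [conjR] using h.conjR_eq
  have h3 : b⁻¹ * a⁻¹ * b = (a * comm a b)⁻¹ := by simp only [comm]; group
  calc a ^ (-2 : ℤ) = a⁻¹ * (comm a b * (a * comm a b)⁻¹) := by group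
    _ = a⁻¹ * (comm a b * (b⁻¹ * ((comm a b)⁻¹ * a * comm a b) * b)) := by rw [h2, h3]
    _ = _ := by rw [zpow_neg, h1]; group

theorem comm_mem_normalizer (h : IsMacdonaldPair p q a b) (hb : IsOfFinOrder b) :
    comm a b ∈ Subgroup.normalizer (Subgroup.zpowers b : Set T) :=
  mem_normalizer_zpowers_of_conj hb h.conjL_eq

theorem comm_mem_normalizer_left (h : IsMacdonaldPair p q a b) (ha : IsOfFinOrder a) :
    comm a b ∈ Subgroup.normalizer (Subgroup.zpowers a : Set T) := by
  simpa using inv_mem (mem_normalizer_zpowers_of_conj ha h.comm_mul_inv)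

theorem conj_zpow_mem (h : IsMacdonaldPair p q a b) (hb : IsOfFinOrder b) (k : ℤ) :
    a⁻¹ * b ^ k * a * comm a b ^ k ∈ Subgroup.zpowers b := by
  have h1 := mul_zpow_mul_zpow_neg_mem (inv_mem (h.comm_mem_normalizer hb))
    (Subgroup.mem_zpowers b) k
  have h2 : b * (comm a b)⁻¹ = a⁻¹ * b * a := by simp only [comm]; group
  have h3 : (a⁻¹ * b * a) ^ k = a⁻¹ * b ^ k * a := by
    simpa using conj_zpow (i := k) (a := a⁻¹) (b := b)
  rw [h2, h3, inv_zpow, zpow_neg, inv_inv] at h1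
  exact h1

/-- By `zpow_neg_two_eq` and `conj_zpow_mem`, `a ^ (-2)` lies in the coset `⟨b⟩ c ^ (q + 1)`. As `c`
has finite order and normalizes `⟨b⟩`, a further power lands in the finite group `⟨b⟩`. -/
theorem isOfFinOrder_left_of_neg_one (h : IsMacdonaldPair (-1) q a b) (hq : 2 ≤ |q|) :
    IsOfFinOrder a := by
  have hb := h.isOfFinOrder_right_of_neg_one hq
  have hc := h.isOfFinOrder_comm' hb
  have hn := h.comm_mem_normalizer hb
  have h1 := h.conj_zpow_mem hb (-q)
  have h2 : comm a b ^ q * b ^ q * (comm a b ^ q)⁻¹ ∈ Subgroup.zpowers b :=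
    (Subgroup.mem_normalizer_iff.mp (zpow_mem hn q) _).mp ⟨q, rfl⟩
  have h3 := mul_zpow_mul_zpow_neg_mem (zpow_mem hn (q + 1)) (mul_mem h1 h2)
    (orderOf (comm a b))
  have h4 : a⁻¹ * b ^ (-q) * a * comm a b ^ (-q) *
      (comm a b ^ q * b ^ q * (comm a b ^ q)⁻¹) * comm a b ^ (q + 1) = a ^ (-2 : ℤ) := by
    rw [h.zpow_neg_two_eq]; group
  rw [h4, ← zpow_mul (comm a b), mul_comm (q + 1), zpow_mul (comm a b), zpow_neg (comm a b),
    zpow_natCast (comm a b), pow_orderOf_eq_one, inv_one, one_zpow, mul_one, ← zpow_mul] at h3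
  refine isOfFinOrder_of_zpow (m := -2 * (orderOf (comm a b) : ℤ)) ?_ ?_
  · have := hc.orderOf_pos; omega
  · obtain ⟨k, hk⟩ := h3
    rw [← hk]
    exact hb.zpow

/-- Here `a ^ (-2) = b ^ 2` commutes with `a` and `b`, hence with `c`, while `c` inverts `a`; so `a
^ 2 = a ^ (-2)`. -/
theorem isOfFinOrder_of_neg_one_neg_one (h : IsMacdonaldPair (-1) (-1) a b) :
    IsOfFinOrder a := by
  have h1 : b = (comm a b)⁻¹ * b⁻¹ * comm a b := by
    have := h.conjL_eq
    rw [conjL, zpow_neg_one, mul_inv_eq_iff_eq_mul] at this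
    rw [mul_assoc, ← this]
    group
  have h2 : a ^ (-2 : ℤ) = b * b := by
    have e : a⁻¹ * b * a = b * (comm a b)⁻¹ := by simp only [comm]; group
    calc a ^ (-2 : ℤ) = b * ((comm a b)⁻¹ * b⁻¹ * comm a b) := by
          rw [h.zpow_neg_two_eq, neg_neg, zpow_one, e, zpow_neg_one]; group
      _ = b * b := by rw [← h1]
  have hb : Commute (a ^ (-2 : ℤ)) b := by
    rw [h2]; exact (Commute.refl b).mul_left (Commute.refl b)
  have ha : Commute (a ^ (-2 : ℤ)) a := (Commute.refl a).zpow_left _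
  have hc : Commute (comm a b) (a ^ (-2 : ℤ)) :=
    (((ha.inv_right.mul_right hb.inv_right).mul_right ha).mul_right hb).symm
  have h3 := conj_zpow (i := -2) (a := (comm a b)⁻¹) (b := a)
  rw [h.comm_mul_inv, ← zpow_mul, inv_inv, mul_assoc, ← hc.eq, inv_mul_cancel_left] at h3
  exact isOfFinOrder_of_zpow_eq (by norm_num) h3

theorem isOfFinOrder_left_of_zero (h : IsMacdonaldPair p 0 a b) (hp : p ≠ 1) :
    IsOfFinOrder a := by
  have hb : b = 1 := by simpa [conjL] using h.conjL_eq
  have hc : comm a b = 1 := by simp [comm, hb]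
  refine isOfFinOrder_of_zpow_eq hp.symm ?_
  simpa [hc, conjR] using h.conjR_eq

theorem isOfFinOrder_left (h : IsMacdonaldPair p q a b) (hp : p ≠ 1) (hq : q ≠ 1) :
    IsOfFinOrder a := by
  have tri (n : ℤ) (hn : n ≠ 1) : n = 0 ∨ n = -1 ∨ 2 ≤ |n| := by
    rcases abs_cases n with ⟨e, _⟩ | ⟨e, _⟩ <;> omega
  rcases tri p hp with rfl | rfl | hp2
  · have := h.conjR_eq
    rw [zpow_zero, conjR, mul_assoc, inv_mul_eq_one, eq_comm, mul_eq_right] at this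
    rw [this]
    exact IsOfFinOrder.one
  · rcases tri q hq with rfl | rfl | hq2
    · exact h.isOfFinOrder_left_of_zero hp
    · exact h.isOfFinOrder_of_neg_one_neg_one
    · exact h.isOfFinOrder_left_of_neg_one hq2
  · rcases tri q hq with rfl | rfl | hq2
    · exact h.isOfFinOrder_left_of_zero hp
    · exact h.symm.isOfFinOrder_right_of_neg_one hp2
    · exact h.isOfFinOrder_left_of_two_le hp2 hq2

theorem isOfFinOrder_right (h : IsMacdonaldPair p q a b) (hp : p ≠ 1) (hq : q ≠ 1) :
    IsOfFinOrder b :=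
  h.symm.isOfFinOrder_left hq hp

open scoped Pointwise in
/-- A Macdonald pair of elements of finite order generates a finite group: it is the product
of the cyclic subgroups generated by `a`, `[a, b]` and `b`. -/
theorem finite_of_closure_eq_top (h : IsMacdonaldPair p q a b) (ha : IsOfFinOrder a)
    (hb : IsOfFinOrder b) (htop : Subgroup.closure {a, b} = ⊤) : Finite T := by
  have hc := h.isOfFinOrder_comm ha
  set S : Set T := {g | ∃ i j k : ℤ, a ^ i * comm a b ^ j * b ^ k = g} with hS
  have hSfin : S.Finite := by
    have e : S ⊆ ((Subgroup.zpowers a : Set T) * (Subgroup.zpowers (comm a b) : Set T)) *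
        (Subgroup.zpowers b : Set T) := by
      rintro _ ⟨i, j, k, rfl⟩
      exact Set.mul_mem_mul (Set.mul_mem_mul ⟨i, rfl⟩ ⟨j, rfl⟩) ⟨k, rfl⟩
    refine Set.Finite.subset (Set.Finite.mul (Set.Finite.mul ?_ ?_) ?_) e
    · exact ha.finite_zpowers
    · exact hc.finite_zpowers
    · exact hb.finite_zpowers
  -- Elements whose right multiplication preserves `S`. Since `1 ∈ S`, it suffices that `M` is
  -- everything.
  let M : Submonoid T :=
    { carrier := {g | ∀ s ∈ S, s * g ∈ S}
      one_mem' := fun s hs ↦ by simpa using hs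
      mul_mem' := fun {x y} hx hy s hs ↦ by
        rw [← mul_assoc]; exact hy _ (hx _ hs) }
  have hbM : b ∈ M := by
    rintro _ ⟨i, j, k, rfl⟩
    exact ⟨i, j, k + 1, by rw [zpow_add_one]; group⟩
  have haM : a ∈ M := by
    rintro _ ⟨i, j, k, rfl⟩
    -- `c ^ j * a = a ^ l * c ^ j` and `b ^ k * a = a * c ^ (-k) * b ^ m`, which puts `a ^ i * c ^ j
    -- * b ^ k * a` back in normal form.
    obtain ⟨l, hl⟩ := (Subgroup.mem_normalizer_iff.mp
      (zpow_mem (h.comm_mem_normalizer_left ha) j) a).mp (Subgroup.mem_zpowers a)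
    obtain ⟨m, hm⟩ := (Subgroup.mem_normalizer_iff.mp
      (zpow_mem (h.comm_mem_normalizer hb) k) _).mp (h.conj_zpow_mem hb k)
    simp only at hl hm
    refine ⟨i + l, j - k, m, ?_⟩
    rw [zpow_add, hl, hm]
    group
  have hinv {x : T} (hx : IsOfFinOrder x) (hxM : x ∈ M) : x⁻¹ ∈ M := by
    have : x⁻¹ = x ^ (orderOf x - 1) := by
      rw [pow_sub _ hx.orderOf_pos, pow_orderOf_eq_one]; simp
    rw [this]
    exact pow_mem hxM _
  have hall (g : T) : g ∈ M := by
    have hg : g ∈ Subgroup.closure {a, b} := htop ▸ Subgroup.mem_top g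
    induction hg using Subgroup.closure_induction'' with
    | mem x hx => rcases hx with rfl | rfl <;> assumption
    | inv_mem x hx =>
      rcases hx with rfl | rfl
      · exact hinv ha haM
      · exact hinv hb hbM
    | one => exact M.one_mem
    | mul x y _ _ hx hy => exact M.mul_mem hx hy
  have huniv : S = Set.univ :=
    Set.eq_univ_of_forall fun g ↦ by
      simpa using hall g 1 ⟨0, 0, 0, by simp⟩
  rw [huniv] at hSfin
  exact Set.finite_univ_iff.mp hSfin

end IsMacdonaldPair
end Wamsley

/-! ### Inverting exponents, universal properties, and the two presentations of `W`. -/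

namespace Wamsley

theorem zpow_mul_eq_self_of_modEq {T : Type*} [Group T] {y : T} {β μ : ℤ} {n : ℕ}
    (hn : orderOf y ∣ n) (h : β * μ ≡ 1 [ZMOD (n : ℤ)]) : y ^ (β * μ) = y := by
  have := (zpow_eq_zpow_iff_modEq (x := y)).mpr (h.of_dvd (Int.natCast_dvd_natCast.mpr hn))
  rwa [zpow_one] at this

theorem comm_conjR {T : Type*} [Group T] (x y z : T) :
    comm (conjR x z) (conjR y z) = conjR (comm x y) z := by
  simp only [comm, conjR]; group

theorem conjL_eq_zpow_iff {T : Type*} [Group T] {y z : T} {β μ : ℤ} (h : y ^ (β * μ) = y) :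
    conjL z y = y ^ β ↔ conjR y z = y ^ μ := by
  constructor <;> intro h1
  · have h2 := conj_zpow (i := μ) (a := z) (b := y)
    rw [show z * y * z⁻¹ = y ^ β from h1, ← zpow_mul, h] at h2
    rw [conjR]
    nth_rw 1 [h2]
    group
  · have h2 := conj_zpow (i := β) (a := z⁻¹) (b := y)
    rw [inv_inv, show z⁻¹ * y * z = y ^ μ from h1, ← zpow_mul, mul_comm, h] at h2
    rw [conjL]
    nth_rw 1 [h2]
    group

/-- Conjugation by `c` permutes the finite group `⟨x⟩`; take `k` with `x ^ k = c⁻¹ * x * c`. -/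
theorem exists_mul_modEq_one_of_conj {T : Type*} [Group T] {x c : T} {p : ℤ}
    (hx : IsOfFinOrder x) (h : c * x * c⁻¹ = x ^ p) :
    ∃ k : ℤ, p * k ≡ 1 [ZMOD (orderOf x : ℤ)] := by
  obtain ⟨k, hk⟩ := (Subgroup.mem_normalizer_iff''.mp (mem_normalizer_zpowers_of_conj hx h) x).mp
    (Subgroup.mem_zpowers x)
  refine ⟨k, zpow_eq_zpow_iff_modEq.mp ?_⟩
  simp only at hk
  rw [zpow_one, zpow_mul, ← h, conj_zpow, hk]
  group

theorem exists_base_mul_modEq_one_of_conj {T : Type*} [Group T] {x c : T} {p : ℤ} {γ : ℕ}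
    (hγ : 0 < γ) (hx : IsOfFinOrder x) (h : c * x * c⁻¹ = x ^ (p ^ γ)) :
    ∃ k : ℤ, p * k ≡ 1 [ZMOD (orderOf x : ℤ)] := by
  obtain ⟨k, hk⟩ := exists_mul_modEq_one_of_conj hx h
  refine ⟨p ^ (γ - 1) * k, ?_⟩
  rwa [← mul_assoc, ← pow_succ', Nat.sub_add_cancel hγ]

theorem IsMacdonaldPair.map {S T : Type*} [Group S] [Group T] {p q : ℤ} {a b : S}
    (h : IsMacdonaldPair p q a b) (f : S →* T) : IsMacdonaldPair p q (f a) (f b) := by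
  refine ⟨?_, ?_⟩
  · simpa [conjR, comm] using congrArg f h.conjR_eq
  · simpa [conjL, comm] using congrArg f h.conjL_eq

theorem isMacdonaldPair_A_B (α β : ℤ) (γ : ℕ) :
    IsMacdonaldPair (α ^ γ) (β ^ γ) (A α β γ) (B α β γ) := by
  refine ⟨?_, ?_⟩
  · have h := PresentedGroup.one_of_mem (rels := macdonaldRelators α β γ
      (FreeGroup.of (0 : Fin 2)) (FreeGroup.of 1)) (Or.inl rfl)
    simp only [conjR, comm, map_mul, map_inv, map_zpow, mul_inv_eq_one] at h
    exact h
  · have h := PresentedGroup.one_of_mem (rels := macdonaldRelators α β γ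
      (FreeGroup.of (0 : Fin 2)) (FreeGroup.of 1)) (Or.inr rfl)
    simp only [conjL, comm, map_mul, map_inv, map_zpow, mul_inv_eq_one] at h
    exact h

theorem closure_A_B (α β : ℤ) (γ : ℕ) : Subgroup.closure {A α β γ, B α β γ} = ⊤ := by
  rw [eq_top_iff]
  intro x _
  refine PresentedGroup.generated_by _ _ (fun j ↦ Subgroup.subset_closure ?_) x
  fin_cases j
  · exact Or.inl rfl
  · exact Or.inr rfl

theorem hom_ext_G {α β : ℤ} {γ : ℕ} {T : Type*} [Group T] {f g : G α β γ →* T}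
    (hA : f (A α β γ) = g (A α β γ)) (hB : f (B α β γ) = g (B α β γ)) : f = g := by
  refine PresentedGroup.ext fun j ↦ ?_
  fin_cases j
  exacts [hA, hB]

theorem finite_G {α β : ℤ} {γ : ℕ} (hα : α ^ γ ≠ 1) (hβ : β ^ γ ≠ 1) : Finite (G α β γ) :=
  (isMacdonaldPair_A_B α β γ).finite_of_closure_eq_top
    ((isMacdonaldPair_A_B α β γ).isOfFinOrder_left hα hβ)
    ((isMacdonaldPair_A_B α β γ).isOfFinOrder_right hα hβ) (closure_A_B α β γ)

theorem exists_mul_modEq_one_orderOf_B {α β : ℤ} {γ : ℕ} (hγ : 0 < γ) (hα : α ^ γ ≠ 1)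
    (hβ : β ^ γ ≠ 1) : ∃ μ : ℤ, β * μ ≡ 1 [ZMOD (orderOf (B α β γ) : ℤ)] :=
  exists_base_mul_modEq_one_of_conj hγ
    ((isMacdonaldPair_A_B α β γ).isOfFinOrder_right hα hβ) (isMacdonaldPair_A_B α β γ).conjL_eq

/-- The homomorphism from the Macdonald group given by a Macdonald pair. -/
def liftG {α β : ℤ} {γ : ℕ} {T : Type*} [Group T] {a b : T}
    (h : IsMacdonaldPair (α ^ γ) (β ^ γ) a b) : G α β γ →* T :=
  PresentedGroup.toGroup (f := ![a, b]) (by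
    rintro r (rfl | rfl)
    · simpa [conjR, comm, mul_inv_eq_one] using h.conjR_eq
    · simpa [conjL, comm, mul_inv_eq_one] using h.conjL_eq)

theorem liftG_A {α β : ℤ} {γ : ℕ} {T : Type*} [Group T] {a b : T}
    (h : IsMacdonaldPair (α ^ γ) (β ^ γ) a b) : liftG h (A α β γ) = a :=
  PresentedGroup.toGroup.of _

theorem liftG_B {α β : ℤ} {γ : ℕ} {T : Type*} [Group T] {a b : T}
    (h : IsMacdonaldPair (α ^ γ) (β ^ γ) a b) : liftG h (B α β γ) = b :=
  PresentedGroup.toGroup.of _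

/-- `b` is the image of `B`, so its order divides that of `B` and the congruence for `μ` carries
over. -/
theorem zpow_mul_eq_self_of_isMacdonaldPair {α β μ : ℤ} {γ : ℕ} {T : Type*} [Group T] {a b : T}
    (h : IsMacdonaldPair (α ^ γ) (β ^ γ) a b)
    (hμ : β * μ ≡ 1 [ZMOD (orderOf (B α β γ) : ℤ)]) : b ^ (β * μ) = b := by
  refine zpow_mul_eq_self_of_modEq ?_ hμ
  have := orderOf_map_dvd (liftG h) (B α β γ)
  rwa [liftG_B] at this

/-- Elements `x`, `y`, `z` satisfying the three relations of the Wamsley group. -/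
structure IsWamsleyTriple {T : Type*} [Group T] (α β : ℤ) (γ : ℕ) (x y z : T) : Prop where
  conjR_eq : conjR x z = x ^ α
  conjL_eq : conjL z y = y ^ β
  pow_eq : z ^ γ = comm x y

theorem isWamsleyTriple_X_Y_Z (α β : ℤ) (γ : ℕ) :
    IsWamsleyTriple α β γ (X α β γ) (Y α β γ) (Z α β γ) :=
  ⟨conjR_X_Z α β γ, conjL_Z_Y α β γ, Z_pow α β γ⟩

namespace IsWamsleyTriple

variable {T : Type*} [Group T] {α β μ : ℤ} {γ : ℕ} {x y z : T}

theorem isMacdonaldPair (h : IsWamsleyTriple α β γ x y z) :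
    IsMacdonaldPair (α ^ γ) (β ^ γ) x y :=
  ⟨by rw [← h.pow_eq]; exact conjR_pow h.conjR_eq γ,
    by rw [← h.pow_eq]; exact conjL_pow h.conjL_eq γ⟩

/-- Both arguments are conjugates by `z ^ i`, and `[x,y] = z ^ γ` commutes with `z ^ i`. -/
theorem comm_zpow_eq (h : IsWamsleyTriple α β γ x y z) (hy : y ^ (β * μ) = y) (i : ℕ) :
    comm (x ^ (α ^ i)) (y ^ (μ ^ i)) = comm x y := by
  rw [← conjR_pow h.conjR_eq i, ← conjR_pow ((conjL_eq_zpow_iff hy).mp h.conjL_eq) i]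
  rw [comm_conjR, ← h.pow_eq, conjR]
  group

/-- The homomorphism from the Wamsley group given by a Wamsley triple. -/
def lift (h : IsWamsleyTriple α β γ x y z) : W α β γ →* T :=
  PresentedGroup.toGroup (f := ![x, y, z]) (by
    rintro r (rfl | rfl | rfl)
    · simpa [conjR, comm, mul_inv_eq_one] using h.conjR_eq
    · simpa [conjL, comm, mul_inv_eq_one] using h.conjL_eq
    · have e := h.pow_eq
      rw [comm, ← mul_inv_eq_one] at e
      simpa [comm] using e)

theorem lift_X (h : IsWamsleyTriple α β γ x y z) : h.lift (X α β γ) = x :=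
  PresentedGroup.toGroup.of _

theorem lift_Y (h : IsWamsleyTriple α β γ x y z) : h.lift (Y α β γ) = y :=
  PresentedGroup.toGroup.of _

theorem lift_Z (h : IsWamsleyTriple α β γ x y z) : h.lift (Z α β γ) = z :=
  PresentedGroup.toGroup.of _

theorem eq_one_of_mem_macdonaldRelators_union (h : IsWamsleyTriple α β γ x y z)
    (hy : y ^ (β * μ) = y) {r : T}
    (hr : r ∈ macdonaldRelators α β γ x y ∪ commRelators α μ γ x y) : r = 1 := by
  rcases hr with (rfl | rfl) | ⟨i, -, -, rfl⟩
  · exact mul_inv_eq_one.mpr h.isMacdonaldPair.conjR_eq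
  · exact mul_inv_eq_one.mpr h.isMacdonaldPair.conjL_eq
  · exact mul_inv_eq_one.mpr (h.comm_zpow_eq hy i)

theorem eq_one_of_mem_extRelators (h : IsWamsleyTriple α β γ x y z)
    (hy : y ^ (β * μ) = y) {r : T} (hr : r ∈ extRelators α β γ μ x y z) : r = 1 := by
  rcases hr with hr | rfl | rfl | rfl
  · exact h.eq_one_of_mem_macdonaldRelators_union hy hr
  · exact mul_inv_eq_one.mpr h.conjR_eq
  · exact mul_inv_eq_one.mpr ((conjL_eq_zpow_iff hy).mp h.conjL_eq)
  · exact mul_inv_eq_one.mpr h.pow_eq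

theorem eq_one_of_mem_extRelators' (h : IsWamsleyTriple α β γ x y z)
    (hy : y ^ (β * μ) = y) {r : T} (hr : r ∈ extRelators' α β γ μ x y z) : r = 1 := by
  rcases hr with hr | rfl | rfl | rfl
  · exact h.eq_one_of_mem_macdonaldRelators_union hy hr
  · exact mul_inv_eq_one.mpr h.conjR_eq
  · exact mul_inv_eq_one.mpr h.conjL_eq
  · exact mul_inv_eq_one.mpr h.pow_eq

end IsWamsleyTriple

theorem map_comm {S T : Type*} [Group S] [Group T] (f : S →* T) (a b : S) :
    f (comm a b) = comm (f a) (f b) := by simp [comm]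

theorem map_conjR {S T : Type*} [Group S] [Group T] (f : S →* T) (a b : S) :
    f (conjR a b) = conjR (f a) (f b) := by simp [conjR]

theorem map_conjL {S T : Type*} [Group S] [Group T] (f : S →* T) (a b : S) :
    f (conjL a b) = conjL (f a) (f b) := by simp [conjL]

theorem map_mem_macdonaldRelators_union {S T : Type*} [Group S] [Group T] (f : S →* T)
    {α β μ : ℤ} {γ : ℕ} {a b r : S}
    (hr : r ∈ macdonaldRelators α β γ a b ∪ commRelators α μ γ a b) :
    f r ∈ macdonaldRelators α β γ (f a) (f b) ∪ commRelators α μ γ (f a) (f b) := by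
  rcases hr with (rfl | rfl) | ⟨i, h1, h2, rfl⟩
  · exact Or.inl (Or.inl (by simp only [map_comm, map_conjR, map_mul, map_inv, map_zpow]))
  · exact Or.inl (Or.inr (by simp [map_comm, map_conjL]))
  · exact Or.inr ⟨i, h1, h2, by simp only [map_comm, map_mul, map_inv, map_zpow]⟩

theorem map_mem_extRelators {S T : Type*} [Group S] [Group T] (f : S →* T)
    {α β μ : ℤ} {γ : ℕ} {a b d r : S} (hr : r ∈ extRelators α β γ μ a b d) :
    f r ∈ extRelators α β γ μ (f a) (f b) (f d) := by
  rcases hr with hr | rfl | rfl | rfl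
  · exact Or.inl (map_mem_macdonaldRelators_union f hr)
  · exact Or.inr (Or.inl (by simp only [map_conjR, map_mul, map_inv, map_zpow]))
  · exact Or.inr (Or.inr (Or.inl (by simp only [map_conjR, map_mul, map_inv, map_zpow])))
  · exact Or.inr (Or.inr (Or.inr (by simp [map_comm])))

theorem map_mem_extRelators' {S T : Type*} [Group S] [Group T] (f : S →* T)
    {α β μ : ℤ} {γ : ℕ} {a b d r : S} (hr : r ∈ extRelators' α β γ μ a b d) :
    f r ∈ extRelators' α β γ μ (f a) (f b) (f d) := by
  rcases hr with hr | rfl | rfl | rfl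
  · exact Or.inl (map_mem_macdonaldRelators_union f hr)
  · exact Or.inr (Or.inl (by simp only [map_conjR, map_mul, map_inv, map_zpow]))
  · exact Or.inr (Or.inr (Or.inl (by simp only [map_conjL, map_mul, map_inv, map_zpow])))
  · exact Or.inr (Or.inr (Or.inr (by simp [map_comm])))

/-- A presentation on three generators that holds in `W`, and whose relations imply those of
`W`, is a presentation of `W`. -/
theorem exists_mulEquiv_W {α β : ℤ} {γ : ℕ} {rels : Set (FreeGroup (Fin 3))}
    (h : ∀ r ∈ rels, FreeGroup.lift ![X α β γ, Y α β γ, Z α β γ] r = 1)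
    (h' : IsWamsleyTriple α β γ (PresentedGroup.of (rels := rels) 0)
      (PresentedGroup.of 1) (PresentedGroup.of 2)) :
    ∃ e : PresentedGroup rels ≃* W α β γ, e (PresentedGroup.of 0) = X α β γ ∧
      e (PresentedGroup.of 1) = Y α β γ ∧ e (PresentedGroup.of 2) = Z α β γ := by
  have h0 : PresentedGroup.toGroup h (PresentedGroup.of 0) = X α β γ := PresentedGroup.toGroup.of h
  have h1 : PresentedGroup.toGroup h (PresentedGroup.of 1) = Y α β γ := PresentedGroup.toGroup.of h
  have h2 : PresentedGroup.toGroup h (PresentedGroup.of 2) = Z α β γ := PresentedGroup.toGroup.of h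
  refine ⟨MonoidHom.toMulEquiv (PresentedGroup.toGroup h) h'.lift ?_ ?_, h0, h1, h2⟩
  · refine PresentedGroup.ext fun j ↦ ?_
    fin_cases j
    · exact (congrArg h'.lift h0).trans h'.lift_X
    · exact (congrArg h'.lift h1).trans h'.lift_Y
    · exact (congrArg h'.lift h2).trans h'.lift_Z
  · refine PresentedGroup.ext fun j ↦ ?_
    fin_cases j
    · exact (congrArg _ h'.lift_X).trans h0
    · exact (congrArg _ h'.lift_Y).trans h1
    · exact (congrArg _ h'.lift_Z).trans h2

theorem exists_mulEquiv_E {α β μ : ℤ} {γ : ℕ}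
    (hμ : β * μ ≡ 1 [ZMOD (orderOf (B α β γ) : ℤ)]) :
    ∃ e : E α β γ μ ≃* W α β γ, e (PresentedGroup.of 0) = X α β γ ∧
      e (PresentedGroup.of 1) = Y α β γ ∧ e (PresentedGroup.of 2) = Z α β γ := by
  have hW := isWamsleyTriple_X_Y_Z α β γ
  refine exists_mulEquiv_W (fun r hr ↦ ?_) ?_
  · have := map_mem_extRelators (FreeGroup.lift ![X α β γ, Y α β γ, Z α β γ]) hr
    simp only [FreeGroup.lift_apply_of] at this
    exact hW.eq_one_of_mem_extRelators
      (zpow_mul_eq_self_of_isMacdonaldPair hW.isMacdonaldPair hμ) this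
  · set rels := extRelators α β γ μ (FreeGroup.of (0 : Fin 3)) (FreeGroup.of 1) (FreeGroup.of 2)
    have hrel {r s : FreeGroup (Fin 3)} (hr : r * s⁻¹ ∈ rels) :
        PresentedGroup.mk rels r = PresentedGroup.mk rels s :=
      PresentedGroup.mk_eq_mk_of_mul_inv_mem hr
    have hM : IsMacdonaldPair (α ^ γ) (β ^ γ) (PresentedGroup.of (rels := rels) 0)
        (PresentedGroup.of 1) := by
      refine ⟨?_, ?_⟩
      · simpa only [PresentedGroup.of, map_conjR, map_comm, map_zpow] using hrel (Or.inl (Or.inl (Or.inl rfl)))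
      · simpa only [PresentedGroup.of, map_conjL, map_comm, map_zpow] using hrel (Or.inl (Or.inl (Or.inr rfl)))
    refine ⟨?_, ?_, ?_⟩
    · simpa only [PresentedGroup.of, map_conjR, map_zpow] using hrel (Or.inr (Or.inl rfl))
    -- The Macdonald relators are needed here: they control the order of `b`, so that `β` and `μ`
    -- are mutually inverse exponents on it.
    · rw [conjL_eq_zpow_iff (zpow_mul_eq_self_of_isMacdonaldPair hM hμ)]
      simpa only [PresentedGroup.of, map_conjR, map_zpow] using hrel (Or.inr (Or.inr (Or.inl rfl)))
    · simpa only [PresentedGroup.of, map_comm, map_pow] using hrel (Or.inr (Or.inr (Or.inr rfl)))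

theorem exists_mulEquiv_E' {α β μ : ℤ} {γ : ℕ}
    (hμ : β * μ ≡ 1 [ZMOD (orderOf (B α β γ) : ℤ)]) :
    ∃ e : E' α β γ μ ≃* W α β γ, e (PresentedGroup.of 0) = X α β γ ∧
      e (PresentedGroup.of 1) = Y α β γ ∧ e (PresentedGroup.of 2) = Z α β γ := by
  have hW := isWamsleyTriple_X_Y_Z α β γ
  refine exists_mulEquiv_W (fun r hr ↦ ?_) ?_
  · have := map_mem_extRelators' (FreeGroup.lift ![X α β γ, Y α β γ, Z α β γ]) hr
    simp only [FreeGroup.lift_apply_of] at this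
    exact hW.eq_one_of_mem_extRelators'
      (zpow_mul_eq_self_of_isMacdonaldPair hW.isMacdonaldPair hμ) this
  · set rels := extRelators' α β γ μ (FreeGroup.of (0 : Fin 3)) (FreeGroup.of 1) (FreeGroup.of 2)
    have hrel {r s : FreeGroup (Fin 3)} (hr : r * s⁻¹ ∈ rels) :
        PresentedGroup.mk rels r = PresentedGroup.mk rels s :=
      PresentedGroup.mk_eq_mk_of_mul_inv_mem hr
    refine ⟨?_, ?_, ?_⟩
    · simpa only [PresentedGroup.of, map_conjR, map_zpow] using hrel (Or.inr (Or.inl rfl))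
    · simpa only [PresentedGroup.of, map_conjL, map_zpow] using hrel (Or.inr (Or.inr (Or.inl rfl)))
    · simpa only [PresentedGroup.of, map_comm, map_pow] using hrel (Or.inr (Or.inr (Or.inr rfl)))

end Wamsley

/-! ### The cyclic extension of `G ⧸ N₀` and the equality `N = N₀`. -/

namespace Wamsley

universe u

/-- Cyclic extensions: an automorphism `σ` of `Q` fixing `c`, whose `γ`-th power is conjugation
by `c`, is conjugation by an element `d` with `d ^ γ = c` in a group containing `Q`. -/
theorem exists_cyclic_extension {Q : Type u} [Group Q] (σ : MulAut Q) {γ : ℕ} (hγ : 0 < γ)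
    {c : Q} (hc : σ c = c) (hσ : ∀ x, (σ ^ γ) x = c⁻¹ * x * c) :
    ∃ (K : Type u) (_ : Group K) (ι : Q →* K) (d : K), Function.Injective ι ∧
      (∀ x, d⁻¹ * ι x * d = ι (σ x)) ∧ d ^ γ = ι c := by
  -- The generator acts by `σ⁻¹`, because `σ` is to be `x ↦ d⁻¹ * x * d`.
  let φ : Multiplicative ℤ →* MulAut Q := zpowersHom (MulAut Q) σ⁻¹
  let inl : Q →* Q ⋊[φ] Multiplicative ℤ := SemidirectProduct.inl
  let d : Q ⋊[φ] Multiplicative ℤ := SemidirectProduct.inr (Multiplicative.ofAdd 1)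
  have hφ : φ (Multiplicative.ofAdd 1) = σ⁻¹ := by simp [φ]
  have hd (x : Q) : d⁻¹ * inl x * d = inl (σ x) := by
    have := SemidirectProduct.inl_aut_inv (φ := φ) (Multiplicative.ofAdd 1) x
    rw [hφ, inv_inv, map_inv] at this
    exact this.symm
  have hdn (n : ℕ) (x : Q) : (d ^ n)⁻¹ * inl x * d ^ n = inl ((σ ^ n) x) := by
    induction n with
    | zero => simp
    | succ n ih =>
      rw [pow_succ' σ, MulAut.mul_apply, ← hd, ← ih, pow_succ]
      group
  -- `t` is central, and dividing by `⟨t⟩` imposes `d ^ γ = c`. By `htr` the `ℤ`-component of `t ^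
  -- n` is `n * γ`, so `⟨t⟩` meets `Q` trivially and `Q` still embeds.
  set t := d ^ γ * (inl c)⁻¹ with ht
  have hcd : Commute (inl c) d := by
    have := hd c
    rw [hc, mul_assoc, inv_mul_eq_iff_eq_mul] at this
    exact this
  have htd : Commute t d := ((Commute.refl d).pow_left γ).mul_left hcd.inv_left
  have htx (x : Q) : Commute t (inl x) := by
    have h1 := hdn γ x
    rw [hσ, map_mul, map_mul, map_inv, mul_assoc, inv_mul_eq_iff_eq_mul] at h1
    have h2 : inl x * t = t * inl x := by
      rw [ht, ← mul_assoc, h1]; group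
    exact h2.symm
  have htr (n : ℤ) : (SemidirectProduct.rightHom (t ^ n)).toAdd = n * γ := by
    rw [map_zpow, ht, map_mul, map_inv, map_pow]
    simp only [d, inl, SemidirectProduct.rightHom_inl, SemidirectProduct.rightHom_inr]
    simp
  have hnormal : (Subgroup.zpowers t).Normal := by
    refine ⟨?_⟩
    rintro _ ⟨n, rfl⟩ g
    have hg : Commute (t ^ n) g := by
      rw [← SemidirectProduct.inl_left_mul_inr_right g]
      refine ((htx _).zpow_left n).mul_right ?_
      have : SemidirectProduct.inr g.right = d ^ g.right.toAdd := by
        rw [← map_zpow, ← ofAdd_zsmul]; simp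
      rw [this]
      exact (htd.zpow_left n).zpow_right _
    exact ⟨n, by simp only; rw [← hg.eq, mul_inv_cancel_right]⟩
  refine ⟨(Q ⋊[φ] Multiplicative ℤ) ⧸ Subgroup.zpowers t, inferInstance,
    (QuotientGroup.mk' _).comp inl, (d : _ ⧸ Subgroup.zpowers t), ?_, fun x ↦ ?_, ?_⟩
  · rw [injective_iff_map_eq_one]
    intro x hx
    obtain ⟨n, hn⟩ := (QuotientGroup.eq_one_iff _).mp hx
    simp only at hn
    have h1 := htr n
    rw [hn] at h1
    simp only [inl, SemidirectProduct.rightHom_inl, toAdd_one] at h1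
    have hn0 : n = 0 := by
      rcases mul_eq_zero.mp h1.symm with h | h
      · exact h
      · omega
    rw [hn0, zpow_zero] at hn
    exact SemidirectProduct.inl_injective (hn.symm.trans (map_one _).symm)
  · exact congrArg (QuotientGroup.mk' (Subgroup.zpowers t)) (hd x)
  · refine (QuotientGroup.eq (s := Subgroup.zpowers t)).mpr ⟨-1, ?_⟩
    simp only
    rw [zpow_neg_one, ht, hcd.inv_left.pow_right γ |>.symm.eq]
    group

variable {α β : ℤ} {γ : ℕ}

theorem N₀_le_N {μ : ℤ} (hμ : β * μ ≡ 1 [ZMOD (orderOf (B α β γ) : ℤ)]) :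
    N₀ α β γ μ ≤ N α β γ := by
  have : (N α β γ).Normal := MonoidHom.normal_ker _
  refine Subgroup.normalClosure_le_normal ?_
  rintro _ ⟨i, -, -, rfl⟩
  have hW := isWamsleyTriple_X_Y_Z α β γ
  rw [SetLike.mem_coe, N, MonoidHom.mem_ker]
  simp only [map_mul, map_inv, map_comm, map_zpow, Omega_A, Omega_B]
  rw [hW.comm_zpow_eq (zpow_mul_eq_self_of_isMacdonaldPair hW.isMacdonaldPair hμ),
    mul_inv_cancel]

instance (μ : ℤ) : (N₀ α β γ μ).Normal := Subgroup.normalClosure_normal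

/-- The automorphism `a ↦ a ^ α`, `b ↦ b ^ μ` of `G ⧸ N₀`. -/
theorem exists_mulAut_quotient_N₀ (hγ : 0 < γ) (hα : α ^ γ ≠ 1) (hβ : β ^ γ ≠ 1) {μ : ℤ}
    (hμ : β * μ ≡ 1 [ZMOD (orderOf (B α β γ) : ℤ)]) :
    ∃ σ : MulAut (G α β γ ⧸ N₀ α β γ μ),
      σ (A α β γ) = (A α β γ : G α β γ ⧸ N₀ α β γ μ) ^ α ∧
      σ (B α β γ) = (B α β γ : G α β γ ⧸ N₀ α β γ μ) ^ μ ∧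
      σ (comm (A α β γ) (B α β γ) : G α β γ) = (comm (A α β γ) (B α β γ) : G α β γ) ∧
      ∀ x, (σ ^ γ) x = (comm (A α β γ) (B α β γ) : G α β γ)⁻¹ * x *
        (comm (A α β γ) (B α β γ) : G α β γ) := by
  have := finite_G hα hβ
  set π := QuotientGroup.mk' (N₀ α β γ μ)
  set a := π (A α β γ) with ha
  set b := π (B α β γ) with hb
  have hM : IsMacdonaldPair (α ^ γ) (β ^ γ) a b := (isMacdonaldPair_A_B α β γ).map π
  have hbμ : b ^ (β * μ) = b := zpow_mul_eq_self_of_isMacdonaldPair hM hμ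
  have hc : π (comm (A α β γ) (B α β γ)) = comm a b := map_comm _ _ _
  have hbμγ : b ^ (β ^ γ * μ ^ γ) = b := by
    have h1 : (β * μ) ^ γ ≡ 1 [ZMOD (orderOf b : ℤ)] := by
      have := (zpow_eq_zpow_iff_modEq (x := b)).mp (hbμ.trans (zpow_one b).symm)
      simpa using this.pow γ
    rw [mul_pow] at h1
    exact zpow_mul_eq_self_of_modEq dvd_rfl h1
  have hconj : conjR b (comm a b) = b ^ (μ ^ γ) := (conjL_eq_zpow_iff hbμγ).mp hM.conjL_eq
  have hcomm (i : ℕ) (hi : 1 ≤ i) (hiγ : i ≤ γ) :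
      comm (a ^ (α ^ i)) (b ^ (μ ^ i)) = comm a b := by
    rcases hiγ.lt_or_eq with h | rfl
    · have h1 : π (comm (A α β γ ^ (α ^ i)) (B α β γ ^ (μ ^ i)) *
          (comm (A α β γ) (B α β γ))⁻¹) = 1 :=
        (QuotientGroup.eq_one_iff _).mpr (Subgroup.subset_normalClosure ⟨i, hi, h, rfl⟩)
      simpa only [map_mul, map_inv, map_comm, map_zpow, mul_inv_eq_one] using h1
    -- The case `i = γ` is not a relator of `N₀`: both entries are conjugates by `c`, so their
    -- commutator is `c` conjugated by itself.
    · rw [← hM.conjR_eq, ← hconj, comm_conjR, conjR, inv_mul_cancel, one_mul]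
  have hM' : IsMacdonaldPair (α ^ γ) (β ^ γ) (a ^ α) (b ^ μ) := by
    have e : comm (a ^ α) (b ^ μ) = comm a b := by simpa using hcomm 1 le_rfl hγ
    refine ⟨?_, ?_⟩
    · rw [e, ← zpow_mul, mul_comm, zpow_mul, ← hM.conjR_eq]
      simpa [conjR] using (conj_zpow (i := α) (a := (comm a b)⁻¹) (b := a)).symm
    · rw [e, ← zpow_mul, mul_comm, zpow_mul, ← hM.conjL_eq]
      exact (conj_zpow (i := μ) (a := comm a b) (b := b)).symm
  have hker : N₀ α β γ μ ≤ (liftG hM').ker := by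
    refine Subgroup.normalClosure_le_normal ?_
    rintro _ ⟨i, hi, hiγ, rfl⟩
    rw [SetLike.mem_coe, MonoidHom.mem_ker]
    simp only [map_mul, map_inv, map_comm, map_zpow, liftG_A, liftG_B, ← zpow_mul, ← pow_succ']
    -- The substitution shifts `i` to `i + 1`, which may equal `γ`; hence the extra case in `hcomm`.
    rw [hcomm (i + 1) (by omega) (by omega), mul_inv_eq_one]
    simpa using (hcomm 1 le_rfl hγ).symm
  let s : (G α β γ ⧸ N₀ α β γ μ) →* (G α β γ ⧸ N₀ α β γ μ) := QuotientGroup.lift _ (liftG hM') hker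
  have hsa : s a = a ^ α := (QuotientGroup.lift_mk' _ hker _).trans (liftG_A hM')
  have hsb : s b = b ^ μ := (QuotientGroup.lift_mk' _ hker _).trans (liftG_B hM')
  have hsurj : Function.Surjective s := by
    have hle : (⊤ : Subgroup (G α β γ)) ≤ s.range.comap π := by
      rw [← closure_A_B, Subgroup.closure_le]
      rintro _ (rfl | rfl)
      · obtain ⟨k, hk⟩ := exists_base_mul_modEq_one_of_conj hγ (isOfFinOrder_of_finite a)
          hM.comm_mul_inv
        exact ⟨a ^ k, by rw [map_zpow, hsa, ← zpow_mul, zpow_mul_eq_self_of_modEq dvd_rfl hk]⟩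
      · exact ⟨b ^ β, by rw [map_zpow, hsb, ← zpow_mul, mul_comm, hbμ]⟩
    intro x
    obtain ⟨g, rfl⟩ := QuotientGroup.mk'_surjective _ x
    exact hle (Subgroup.mem_top g)
  let σ : MulAut (G α β γ ⧸ N₀ α β γ μ) :=
    MulEquiv.ofBijective s ⟨Finite.injective_iff_surjective.mpr hsurj, hsurj⟩
  have hσa : σ a = a ^ α := hsa
  have hσb : σ b = b ^ μ := hsb
  have hσan (n : ℕ) : (σ ^ n) a = a ^ (α ^ n) := by
    induction n with
    | zero => simp
    | succ n ih => rw [pow_succ', MulAut.mul_apply, ih, map_zpow, hσa, ← zpow_mul, pow_succ']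
  have hσbn (n : ℕ) : (σ ^ n) b = b ^ (μ ^ n) := by
    induction n with
    | zero => simp
    | succ n ih => rw [pow_succ', MulAut.mul_apply, ih, map_zpow, hσb, ← zpow_mul, pow_succ']
  refine ⟨σ, hσa, hσb, ?_, fun x ↦ ?_⟩
  · change σ (π _) = π _
    rw [hc]
    have := map_comm σ.toMonoidHom a b
    simp only [MulEquiv.toMonoidHom_eq_coe, MonoidHom.coe_coe, hσa, hσb] at this
    rw [this]
    simpa using hcomm 1 le_rfl hγ
  · change _ = (π _)⁻¹ * x * π _
    rw [hc]
    have hext : ((σ ^ γ : MulAut _).toMonoidHom).comp π =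
        ((MulAut.conj (comm a b)⁻¹).toMonoidHom).comp π := by
      refine hom_ext_G ?_ ?_
      · simpa [conjR] using (hσan γ).trans hM.conjR_eq.symm
      · simpa [conjR] using (hσbn γ).trans hconj.symm
    obtain ⟨g, rfl⟩ := QuotientGroup.mk'_surjective _ x
    refine (DFunLike.congr_fun hext g).trans ?_
    simp [π]

theorem N_eq_N₀ (hγ : 0 < γ) (hα : α ^ γ ≠ 1) (hβ : β ^ γ ≠ 1) {μ : ℤ}
    (hμ : β * μ ≡ 1 [ZMOD (orderOf (B α β γ) : ℤ)]) : N α β γ = N₀ α β γ μ := by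
  refine le_antisymm ?_ (N₀_le_N hμ)
  obtain ⟨σ, hσa, hσb, hσc, hσ⟩ := exists_mulAut_quotient_N₀ hγ hα hβ hμ
  obtain ⟨K, _, ι, d, hι, hd, hdγ⟩ := exists_cyclic_extension σ hγ hσc hσ
  set f := ι.comp (QuotientGroup.mk' (N₀ α β γ μ))
  have hT : IsWamsleyTriple α β γ (f (A α β γ)) (f (B α β γ)) d := by
    refine ⟨?_, ?_, ?_⟩
    · exact (hd _).trans ((congrArg ι hσa).trans (map_zpow ι _ _))
    · rw [conjL_eq_zpow_iff (zpow_mul_eq_self_of_isMacdonaldPair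
        ((isMacdonaldPair_A_B α β γ).map f) hμ)]
      exact (hd _).trans ((congrArg ι hσb).trans (map_zpow ι _ _))
    · rw [hdγ, ← map_comm]; rfl
  -- `f` has kernel `N₀` because `ι` is injective, and it factors through `Ω`.
  have hcomp : hT.lift.comp (Omega α β γ) = f := by
    refine hom_ext_G ?_ ?_
    · rw [MonoidHom.comp_apply, Omega_A, hT.lift_X]
    · rw [MonoidHom.comp_apply, Omega_B, hT.lift_Y]
  intro x hx
  have h1 : f x = 1 := by
    rw [← hcomp, MonoidHom.comp_apply, MonoidHom.mem_ker.mp hx, map_one]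
  exact (QuotientGroup.eq_one_iff x).mp (hι (h1.trans (map_one ι).symm))

/-! ### The subgroup `⟨X, Y⟩` and the order of `W`. -/

theorem range_Omega (α β : ℤ) (γ : ℕ) : (Omega α β γ).range = XY α β γ := by
  rw [MonoidHom.range_eq_map, ← closure_A_B, MonoidHom.map_closure, Set.image_pair, Omega_A,
    Omega_B, XY]

theorem X_mem_XY (α β : ℤ) (γ : ℕ) : X α β γ ∈ XY α β γ := Subgroup.subset_closure (Or.inl rfl)

theorem Y_mem_XY (α β : ℤ) (γ : ℕ) : Y α β γ ∈ XY α β γ := Subgroup.subset_closure (Or.inr rfl)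

theorem finite_XY (hα : α ^ γ ≠ 1) (hβ : β ^ γ ≠ 1) : Finite (XY α β γ) := by
  have := finite_G hα hβ
  rw [← range_Omega]
  exact Finite.of_surjective _ (Omega α β γ).rangeRestrict_surjective

/-- Conjugation by `Z⁻¹` sends `X`, `Y` to `X ^ α`, `Y ^ μ`, hence `⟨X, Y⟩` into itself; finiteness
of this subgroup gives equality. -/
theorem normal_XY (hγ : 0 < γ) (hα : α ^ γ ≠ 1) (hβ : β ^ γ ≠ 1) : (XY α β γ).Normal := by
  obtain ⟨μ, hμ⟩ := exists_mul_modEq_one_orderOf_B hγ hα hβ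
  have hW := isWamsleyTriple_X_Y_Z α β γ
  have hY := (conjL_eq_zpow_iff
    (zpow_mul_eq_self_of_isMacdonaldPair hW.isMacdonaldPair hμ)).mp hW.conjL_eq
  have : Finite (XY α β γ : Set (W α β γ)) := finite_XY hα hβ
  have hZ : (Z α β γ)⁻¹ ∈ Subgroup.normalizer (XY α β γ : Set (W α β γ)) := by
    refine Subgroup.mem_normalizer_fintype fun n hn ↦ ?_
    have hle : XY α β γ ≤ (XY α β γ).comap (MulAut.conj (Z α β γ)⁻¹).toMonoidHom := by
      rw [XY, Subgroup.closure_le, ← XY]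
      rintro _ (rfl | rfl)
      · have := (XY α β γ).zpow_mem (X_mem_XY α β γ) α
        rw [← hW.conjR_eq] at this
        simpa [conjR] using this
      · have := (XY α β γ).zpow_mem (Y_mem_XY α β γ) μ
        rw [← hY] at this
        simpa [conjR] using this
    exact hle hn
  rw [← Subgroup.normalizer_eq_top_iff, eq_top_iff]
  intro w _
  refine PresentedGroup.generated_by _ _ (fun j ↦ ?_) w
  fin_cases j
  · exact Subgroup.le_normalizer (X_mem_XY α β γ)
  · exact Subgroup.le_normalizer (Y_mem_XY α β γ)
  · exact inv_mem_iff.mp hZ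

theorem isCyclic_and_card_quotient_XY [(XY α β γ).Normal] :
    IsCyclic (W α β γ ⧸ XY α β γ) ∧ Nat.card (W α β γ ⧸ XY α β γ) = γ := by
  set π := QuotientGroup.mk' (XY α β γ)
  have hmem (w : W α β γ) : w ∈ (Subgroup.zpowers (π (Z α β γ))).comap π := by
    refine PresentedGroup.generated_by _ _ (fun j ↦ ?_) w
    have h1 {x : W α β γ} (hx : x ∈ XY α β γ) :
        x ∈ (Subgroup.zpowers (π (Z α β γ))).comap π := by
      rw [Subgroup.mem_comap, show π x = 1 from (QuotientGroup.eq_one_iff x).mpr hx]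
      exact one_mem _
    fin_cases j
    · exact h1 (X_mem_XY α β γ)
    · exact h1 (Y_mem_XY α β γ)
    · exact Subgroup.mem_zpowers (π (Z α β γ))
  have hgen (x : W α β γ ⧸ XY α β γ) : x ∈ Subgroup.zpowers (π (Z α β γ)) := by
    obtain ⟨w, rfl⟩ := QuotientGroup.mk'_surjective _ x
    exact hmem w
  refine ⟨⟨_, hgen⟩, ?_⟩
  rw [← orderOf_eq_card_of_forall_mem_zpowers hgen]
  refine Nat.dvd_antisymm (orderOf_dvd_of_pow_eq_one ?_) ?_
  · rw [← map_pow, Z_pow]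
    refine (QuotientGroup.eq_one_iff _).mpr ?_
    exact mul_mem (mul_mem (mul_mem (inv_mem (X_mem_XY α β γ)) (inv_mem (Y_mem_XY α β γ)))
      (X_mem_XY α β γ)) (Y_mem_XY α β γ)
  -- Killing `X` and `Y` maps `W` to `ℤ/γ` with `Z ↦ 1`, so the order of `Z` modulo `⟨X, Y⟩` is a
  -- multiple of `γ`.
  · have hT : IsWamsleyTriple α β γ (1 : Multiplicative (ZMod γ)) 1
        (Multiplicative.ofAdd 1) := by
      refine ⟨by simp [conjR], by simp [conjL], ?_⟩
      rw [← ofAdd_nsmul]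
      simp [comm]
    have hle : XY α β γ ≤ hT.lift.ker := by
      rw [XY, Subgroup.closure_le]
      rintro _ (rfl | rfl)
      · exact hT.lift_X
      · exact hT.lift_Y
    have h1 := orderOf_map_dvd (QuotientGroup.lift _ hT.lift hle) (π (Z α β γ))
    rw [show QuotientGroup.lift _ hT.lift hle (π (Z α β γ)) = Multiplicative.ofAdd 1 from
      hT.lift_Z, orderOf_ofAdd_eq_addOrderOf, ZMod.addOrderOf_one] at h1
    exact h1

theorem card_W (hγ : 0 < γ) (hα : α ^ γ ≠ 1) (hβ : β ^ γ ≠ 1) :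
    Nat.card (W α β γ) = γ * Nat.card (XY α β γ) := by
  have := normal_XY hγ hα hβ
  rw [Subgroup.card_eq_card_quotient_mul_card_subgroup (XY α β γ),
    isCyclic_and_card_quotient_XY.2]

theorem finite_W (hγ : 0 < γ) (hα : α ^ γ ≠ 1) (hβ : β ^ γ ≠ 1) : Finite (W α β γ) := by
  have := finite_XY hα hβ
  refine Nat.finite_of_card_ne_zero ?_
  rw [card_W hγ hα hβ]
  exact mul_ne_zero hγ.ne' Nat.card_pos.ne'

theorem card_XY_mul_card_N (α β : ℤ) (γ : ℕ) :
    Nat.card (XY α β γ) * Nat.card (N α β γ) = Nat.card (G α β γ) := by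
  rw [← range_Omega, N, ← Nat.card_congr (QuotientGroup.quotientKerEquivRange _).toEquiv,
    ← Subgroup.card_eq_card_quotient_mul_card_subgroup]

end Wamsley

theorem theorem2p2 (α β : ℤ) (γ : ℕ) (hγ : 0 < γ) (hα : α ^ γ ≠ 1) (hβ : β ^ γ ≠ 1) :
    Finite (Wamsley.G α β γ) ∧ Finite (Wamsley.W α β γ) ∧
    (∃ μ : ℤ, β * μ ≡ 1 [ZMOD (orderOf (Wamsley.B α β γ) : ℤ)]) ∧
    ∀ μ : ℤ, β * μ ≡ 1 [ZMOD (orderOf (Wamsley.B α β γ) : ℤ)] →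
      Wamsley.N α β γ = Wamsley.N₀ α β γ μ ∧
      (Wamsley.Omega α β γ).range = Wamsley.XY α β γ ∧
      (∃ _ : (Wamsley.XY α β γ).Normal,
        IsCyclic (Wamsley.W α β γ ⧸ Wamsley.XY α β γ) ∧
        Nat.card (Wamsley.W α β γ ⧸ Wamsley.XY α β γ) = γ) ∧
      (Nat.card (Wamsley.W α β γ) : ℚ) =
        γ * Nat.card (Wamsley.G α β γ) / Nat.card (Wamsley.N₀ α β γ μ) ∧
      (∃ e : Wamsley.E α β γ μ ≃* Wamsley.W α β γ,
        e (PresentedGroup.of 0) = Wamsley.X α β γ ∧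
        e (PresentedGroup.of 1) = Wamsley.Y α β γ ∧
        e (PresentedGroup.of 2) = Wamsley.Z α β γ) ∧
      (∃ e : Wamsley.E' α β γ μ ≃* Wamsley.W α β γ,
        e (PresentedGroup.of 0) = Wamsley.X α β γ ∧
        e (PresentedGroup.of 1) = Wamsley.Y α β γ ∧
        e (PresentedGroup.of 2) = Wamsley.Z α β γ) := by
  have hG := Wamsley.finite_G hα hβ
  refine ⟨hG, Wamsley.finite_W hγ hα hβ, Wamsley.exists_mul_modEq_one_orderOf_B hγ hα hβ,
    fun μ hμ ↦ ?_⟩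
  have hN := Wamsley.N_eq_N₀ hγ hα hβ hμ
  have hnormal := Wamsley.normal_XY hγ hα hβ
  refine ⟨hN, Wamsley.range_Omega α β γ,
    ⟨hnormal, Wamsley.isCyclic_and_card_quotient_XY⟩, ?_,
    Wamsley.exists_mulEquiv_E hμ, Wamsley.exists_mulEquiv_E' hμ⟩
  rw [Wamsley.card_W hγ hα hβ, ← Wamsley.card_XY_mul_card_N, ← hN]
  have : (Nat.card (Wamsley.N α β γ) : ℚ) ≠ 0 := Nat.cast_ne_zero.mpr Nat.card_pos.ne'
  push_cast
  field_simp
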